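/- **Theorem 1.1.** Let $\xi(s)=\tfrac12 s(s-1)\pi^{-s/2}\Gamma(\tfrac s2)\zeta(s)$ and $\Xi(y)=\xi(\tfrac12+iy)$. Let $J_0(z)=\sum_{k\ge0}\frac{(-1)^k}{(k!)^2}\left(\frac z2\right)^{2k}$ and ${}_1F_1(a;b;z)=\sum_{k\ge0}\frac{(a)_k}{(b)_k}\frac{z^k}{k!}$. Let $t,r\in\mathbb C$ with $\Re(t)>0$ and $r^2/t\in\mathbb R$ (for instance $t>0$ and $r\in\mathbb R$), and let $\sqrt t$ be the principal square root. For $y>0$ put $$H_1(y):=\sum_{n=1}^{\infty}e^{-tn^2y^2}J_0(rny)-\frac{\sqrt{\pi}}{2\sqrt t}\,{}_1F_1\left(\tfrac12;1;-\tfrac{r^2}{4t}\right)y^{-1},$$ where the series converges absolutely. Then for every $x\in\mathbb R$ both integrals below converge absolutely and $$\int_{0}^{\infty}\frac{\Xi^2(y)}{(y^2+\frac14)^2}\left|{}_1F_1\left(\tfrac14+\tfrac{iy}2;1;-\tfrac{r^2}{4t}\right)\right|^2\cos(xy)\,dy=e^{-x/2}\sqrt{\pi}\,\sqrt{t}\int_{0}^{\infty}H_1(ye^{-x})H_1(y)\,dy.$$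 -/

import Mathlib

open Set MeasureTheory

noncomputable section

/-- Bessel function of the first kind `J_ν` of order `ν ∈ ℕ`, given by its (everywhere convergent)
power series `∑ (-1)^k / (k! (k+ν)!) (z/2)^(2k+ν)`. -/
def besselJ (ν : ℕ) (z : ℂ) : ℂ :=
  ∑' k : ℕ, (-1 : ℂ) ^ k / ((k.factorial : ℂ) * ((k + ν).factorial : ℂ)) * (z / 2) ^ (2 * k + ν)

/-- Kummer's confluent hypergeometric function `₁F₁(a; b; z) = ∑ (a)_k / ((b)_k k!) z^k`,
where `(a)_k = a (a+1) ⋯ (a+k-1)` is the rising factorial. -/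
def hyp1F1 (a b z : ℂ) : ℂ :=
  ∑' k : ℕ, (ascPochhammer ℂ k).eval a / ((ascPochhammer ℂ k).eval b * (k.factorial : ℂ)) * z ^ k

/-- Riemann's function `ξ(s) = ½ s (s-1) π^{-s/2} Γ(s/2) ζ(s)`, by the formula that is valid away
from the removable singularities at `s = 1` and `s = 0, -2, -4, …`. It is used on `Re s = 1/2`. -/
def riemannXi (s : ℂ) : ℂ :=
  1 / 2 * s * (s - 1) * (Real.pi : ℂ) ^ (-s / 2) * Complex.Gamma (s / 2) * riemannZeta s

/-- `Ξ(y) = ξ(1/2 + i y)` for real `y`. -/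
def upperXi (y : ℝ) : ℂ := riemannXi (1 / 2 + Complex.I * (y : ℂ))

/-- The term with index `n + 1` of the Bessel theta series `∑_{n ≥ 1} e^{-t n² y²} J₀(r n y)`. -/
def besselThetaTerm (t r : ℂ) (y : ℝ) (n : ℕ) : ℂ :=
  Complex.exp (-t * ((n : ℂ) + 1) ^ 2 * (y : ℂ) ^ 2) * besselJ 0 (r * ((n : ℂ) + 1) * (y : ℂ))

/-- `H₁(y) = ∑_{n ≥ 1} e^{-t n² y²} J₀(r n y) - (√π / (2 √t)) ₁F₁(1/2; 1; -r²/(4t)) y⁻¹`, with the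
principal branch of `√t`. -/
def besselH (t r : ℂ) (y : ℝ) : ℂ :=
  (∑' n : ℕ, besselThetaTerm t r y n)
    - (Real.sqrt Real.pi : ℂ) / (2 * t ^ (1 / 2 : ℂ)) * hyp1F1 (1 / 2) 1 (-r ^ 2 / (4 * t))
      * (y : ℂ)⁻¹

/-- The integrand `Ξ(y)² / (y² + 1/4)² · |₁F₁(1/4 + iy/2; 1; -r²/(4t))|² · cos(x y)`. -/
def xiIntegrand (t r : ℂ) (x y : ℝ) : ℂ :=
  upperXi y ^ 2 / ((y : ℂ) ^ 2 + 1 / 4) ^ 2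
    * ((‖hyp1F1 (1 / 4 + Complex.I * (y : ℂ) / 2) 1 (-r ^ 2 / (4 * t))‖ ^ 2 : ℝ) : ℂ)
    * ((Real.cos (x * y) : ℝ) : ℂ)

end

open Filter Topology
open scoped FourierTransform Real ComplexConjugate

noncomputable section

/-! Put `f(u) = exp(-t u²) J₀(r u)`. The Mellin transform of `f` at `s = 1` is the coefficient of
`y⁻¹` in `H₁`, so `H₁(y) = ∑ f(ny) - y⁻¹ ∫ f`. First order Euler-Maclaurin turns this into `∫ f'(u)
{u/y} du`, a multiplicative convolution. With `y = e^{-u}` it becomes an additive convolution, and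
the Fourier transform factors it. Since the Mellin transform of `{1/v}` is `-ζ(s)/s` for `0 < Re s <
1` and that of `f'` at `s + 1` is `-s` times that of `f` at `s`, the product is `ζ(s) (Mf)(s)` on
`Re s = 1/2`. This is Müntz's formula, `StripDecay.fourier_logScale_thetaDefect`.

Termwise integration gives `(Mf)(s) = ½ t^{-s/2} Γ(s/2) ₁F₁(s/2; 1; -r²/(4t))`. At `s = 1/2 + iy`,
the product of the transforms at `s` and `1 - s = conj s` is the weight in the `Ξ` integral up to a
constant (`upperXi_sq_mul_eq`): the zeta and Gamma factors give `Ξ(y) Ξ(-y) = Ξ(y)²`, and the two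
Kummer functions are conjugate because `r²/t` is real. Dilation of `H₁` by `e^{-x}` is translation
in `u`, so Parseval's formula for the correlation of `H₁` with itself is the theorem. -/

/-! ### Zeta as the Mellin transform of a fractional part. -/

theorem locallyIntegrableOn_of_bounded_measurable {f : ℝ → ℂ} {C : ℝ} (hm : Measurable f)
    (hb : ∀ u, ‖f u‖ ≤ C) (s : Set ℝ) : LocallyIntegrableOn f s := by
  have h : LocallyIntegrable f := fun x => by
    refine ⟨Icc (x - 1) (x + 1), Icc_mem_nhds (by linarith) (by linarith), ?_⟩
    exact (integrableOn_const (C := C) (by simp)).mono' hm.aestronglyMeasurable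
      (ae_of_all _ hb)
  exact h.locallyIntegrableOn s

/-- The fractional part of `1 / v`, cut off to `v < 1`. -/
def fractInvCut (v : ℝ) : ℂ := (Ioi (1 : ℝ)).indicator (fun u => ((Int.fract u : ℝ) : ℂ)) v⁻¹

theorem norm_fract_le_one (u : ℝ) : ‖((Int.fract u : ℝ) : ℂ)‖ ≤ 1 := by
  rw [Complex.norm_real, Real.norm_of_nonneg (Int.fract_nonneg u)]
  exact (Int.fract_lt_one u).le

theorem measurable_fractInvCut : Measurable fractInvCut := by
  unfold fractInvCut
  refine Measurable.comp (g := (Ioi (1 : ℝ)).indicator (fun u => ((Int.fract u : ℝ) : ℂ)))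
    ?_ measurable_inv
  exact (Complex.measurable_ofReal.comp measurable_fract).indicator measurableSet_Ioi

theorem norm_fractInvCut_le (v : ℝ) : ‖fractInvCut v‖ ≤ 1 :=
  (norm_indicator_le_norm_self _ _).trans (norm_fract_le_one _)

theorem fractInvCut_eventuallyEq_zero : fractInvCut =ᶠ[atTop] 0 := by
  filter_upwards [eventually_ge_atTop (1 : ℝ)] with v hv
  simp only [fractInvCut, Pi.zero_apply]
  rw [indicator_of_notMem]
  simpa using inv_le_one_of_one_le₀ hv

theorem fractInvCut_isBigO_top (a : ℝ) : fractInvCut =O[atTop] fun x : ℝ => x ^ a :=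
  (Asymptotics.isBigO_zero _ _).congr' fractInvCut_eventuallyEq_zero.symm (by rfl)

theorem fractInvCut_isBigO_zero : fractInvCut =O[𝓝[>] 0] fun x : ℝ => x ^ (-(0 : ℝ)) := by
  refine Asymptotics.IsBigO.of_bound 1 (Eventually.of_forall fun v => ?_)
  simpa using norm_fractInvCut_le v

/-- The cut-off removes the tail `1/v`, so the transform is analytic on the whole half plane and can
be compared with zeta across `Re s = 1`. -/
theorem differentiableAt_mellin_fractInvCut {s : ℂ} (hs : 0 < s.re) :
    DifferentiableAt ℂ (mellin fractInvCut) s :=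
  mellin_differentiableAt_of_isBigO_rpow (a := s.re + 1)
    (locallyIntegrableOn_of_bounded_measurable measurable_fractInvCut norm_fractInvCut_le _)
    (fractInvCut_isBigO_top _) (by linarith) fractInvCut_isBigO_zero hs

theorem mellinConvergent_fractInvCut {s : ℂ} (hs : 0 < s.re) :
    MellinConvergent fractInvCut s :=
  mellinConvergent_of_isBigO_rpow (a := s.re + 1)
    (locallyIntegrableOn_of_bounded_measurable measurable_fractInvCut norm_fractInvCut_le _)
    (fractInvCut_isBigO_top _) (by linarith) fractInvCut_isBigO_zero hs

theorem mellin_fractInvCut_eq_integral (s : ℂ) :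
    mellin fractInvCut s = ∫ u in Ioi (1 : ℝ), (u : ℂ) ^ (-s - 1) * ((Int.fract u : ℝ) : ℂ) := by
  have h := mellin_comp_inv ((Ioi (1 : ℝ)).indicator (fun u => ((Int.fract u : ℝ) : ℂ))) s
  rw [show fractInvCut = fun t => (Ioi (1 : ℝ)).indicator (fun u => ((Int.fract u : ℝ) : ℂ)) t⁻¹
    from rfl, h, mellin]
  simp only [smul_eq_mul]
  have : ∀ t : ℝ, (t : ℂ) ^ (-s - 1) * (Ioi (1 : ℝ)).indicator
      (fun u => ((Int.fract u : ℝ) : ℂ)) t = (Ioi (1 : ℝ)).indicator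
      (fun u => (u : ℂ) ^ (-s - 1) * ((Int.fract u : ℝ) : ℂ)) t := by
    intro t
    by_cases ht : t ∈ Ioi (1 : ℝ) <;> simp [ht]
  simp_rw [this]
  rw [setIntegral_indicator measurableSet_Ioi]
  congr 2
  ext u; simp only [mem_inter_iff, mem_Ioi]
  constructor
  · exact fun h => h.2
  · exact fun h => ⟨by linarith, h⟩

/-- Abel summation gives `ζ(s) = s ∫₁^∞ ⌊u⌋ u^{-s-1} du`; then split `⌊u⌋ = u - {u}`. -/
theorem riemannZeta_eq_sub_mellin_fractInvCut {s : ℂ} (hs : 1 < s.re) :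
    (s - 1) * riemannZeta s = s - s * (s - 1) * mellin fractInvCut s := by
  have hs1 : s - 1 ≠ 0 := by
    intro h
    have := congrArg Complex.re h
    simp at this; linarith
  have hO : (fun n : ℕ => ∑ k ∈ Finset.Icc 1 n, (1 : ℕ → ℂ) k) =O[atTop]
      fun n : ℕ => (n : ℝ) ^ (1 : ℝ) := by
    refine Asymptotics.IsBigO.of_bound 1 (Eventually.of_forall fun n => ?_)
    simp
  have h := LSeries_eq_mul_integral 1 zero_le_one hs (LSeriesSummable_one_iff.2 hs) hO
  rw [LSeries_one_eq_riemannZeta hs] at h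
  have hI1 : IntegrableOn (fun u : ℝ => (u : ℂ) ^ (-s)) (Ioi 1) :=
    integrableOn_Ioi_cpow_of_lt (by simpa using hs) one_pos
  have hI2 : IntegrableOn (fun u : ℝ => (u : ℂ) ^ (-s - 1) * ((Int.fract u : ℝ) : ℂ)) (Ioi 1) := by
    have : IntegrableOn (fun u : ℝ => (u : ℂ) ^ (-s - 1)) (Ioi 1) :=
      integrableOn_Ioi_cpow_of_lt (by simp; linarith) one_pos
    refine this.mul_bdd (c := 1) ?_ (ae_of_all _ norm_fract_le_one)
    exact (Complex.measurable_ofReal.comp measurable_fract).aestronglyMeasurable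
  have key : ∫ t in Ioi (1 : ℝ), (∑ k ∈ Finset.Icc 1 ⌊t⌋₊, (1 : ℕ → ℂ) k) * (t : ℂ) ^ (-(s + 1))
      = ∫ t in Ioi (1 : ℝ), ((t : ℂ) ^ (-s) - (t : ℂ) ^ (-s - 1) * ((Int.fract t : ℝ) : ℂ)) := by
    refine setIntegral_congr_fun measurableSet_Ioi fun t ht => ?_
    have ht0 : (0 : ℝ) < t := one_pos.trans ht
    have h1 : (∑ k ∈ Finset.Icc 1 ⌊t⌋₊, (1 : ℕ → ℂ) k) = (t : ℂ) - ((Int.fract t : ℝ) : ℂ) := by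
      simp only [Pi.one_apply, Finset.sum_const, Nat.card_Icc, add_tsub_cancel_right, nsmul_eq_mul,
        mul_one]
      rw [← Complex.ofReal_sub, Int.self_sub_fract, ← natCast_floor_eq_intCast_floor ht0.le]
      simp
    have h2 : (t : ℂ) ^ (-s) = (t : ℂ) ^ (-s - 1) * t := by
      rw [show -s = -s - 1 + 1 by ring, Complex.cpow_add _ _ (by exact_mod_cast ht0.ne'),
        Complex.cpow_one, add_sub_cancel_right]
    simp only [h1, h2, neg_add']
    ring
  rw [key, integral_sub hI1 hI2, ← mellin_fractInvCut_eq_integral,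
    integral_Ioi_cpow_of_lt (by simpa using hs) one_pos] at h
  rw [h, Complex.ofReal_one, Complex.one_cpow]
  have : -s + 1 ≠ 0 := by
    intro h; apply hs1; linear_combination -h
  field_simp
  ring

theorem sub_one_mul_riemannZeta_eq {s : ℂ} (hs : 0 < s.re) (hs1 : s ≠ 1) :
    (s - 1) * riemannZeta s = s - s * (s - 1) * mellin fractInvCut s := by
  -- The value 1 is the residue of zeta, so `g` is entire and the identity theorem applies on `Re s
  -- > 0`.
  set g : ℂ → ℂ := Function.update (fun s => (s - 1) * riemannZeta s) 1 1 with hg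
  have hgd : ∀ z, z ≠ 1 → DifferentiableAt ℂ g z := fun z hz => by
    have : DifferentiableAt ℂ (fun s => (s - 1) * riemannZeta s) z :=
      (differentiableAt_id.sub_const 1).mul (differentiableAt_riemannZeta hz)
    refine this.congr_of_eventuallyEq ?_
    filter_upwards [isOpen_ne.mem_nhds hz] with w hw
    simp [hg, Function.update_of_ne hw]
  have hg1 : AnalyticAt ℂ g 1 := by
    refine Complex.analyticAt_of_differentiable_on_punctured_nhds_of_continuousAt ?_ ?_
    · filter_upwards [self_mem_nhdsWithin] with z hz using hgd z hz
    · exact continuousAt_update_same.2 riemannZeta_residue_one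
  have hgd' : Differentiable ℂ g := fun z => by
    by_cases hz : z = 1
    · exact hz ▸ hg1.differentiableAt
    · exact hgd z hz
  have hU : IsOpen {z : ℂ | 0 < z.re} := isOpen_lt continuous_const Complex.continuous_re
  have hgA : AnalyticOnNhd ℂ g {z : ℂ | 0 < z.re} :=
    hgd'.differentiableOn.analyticOnNhd hU
  have hfA : AnalyticOnNhd ℂ (fun s => s - s * (s - 1) * mellin fractInvCut s)
      {z : ℂ | 0 < z.re} := by
    refine DifferentiableOn.analyticOnNhd (fun z hz => DifferentiableAt.differentiableWithinAt ?_) hU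
    exact differentiableAt_id.sub ((differentiableAt_id.mul (differentiableAt_id.sub_const 1)).mul
      (differentiableAt_mellin_fractInvCut hz))
  have hev : g =ᶠ[𝓝 2] fun s => s - s * (s - 1) * mellin fractInvCut s := by
    have : {z : ℂ | 1 < z.re} ∈ 𝓝 (2 : ℂ) :=
      (isOpen_lt continuous_const Complex.continuous_re).mem_nhds (by simp)
    filter_upwards [this] with z hz
    have hz1 : z ≠ 1 := by rintro rfl; simp at hz
    simp only [hg, Function.update_of_ne hz1]
    exact riemannZeta_eq_sub_mellin_fractInvCut hz
  have := hgA.eqOn_of_preconnected_of_eventuallyEq hfA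
    (convex_halfSpace_re_gt 0).isPreconnected (z₀ := 2) (by simp) hev hs
  simpa [hg, Function.update_of_ne hs1] using this

/-- The restored tail has Mellin transform `-1/(s - 1)` for `Re s < 1`, which cancels the polar term
of zeta. -/
theorem fract_inv_eq {v : ℝ} (hv : 0 < v) : ((Int.fract v⁻¹ : ℝ) : ℂ) =
    fractInvCut v + (Ioi (1 : ℝ)).indicator (fun u : ℝ => (u : ℂ)⁻¹) v := by
  rcases lt_trichotomy v 1 with h | rfl | h
  · have : 1 < v⁻¹ := (one_lt_inv₀ hv).2 h
    simp [fractInvCut, this, h.le]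
  · simp [fractInvCut]
  · have h1 : v⁻¹ < 1 := inv_lt_one_of_one_lt₀ h
    have h2 : Int.fract v⁻¹ = v⁻¹ := Int.fract_eq_self.2 ⟨by positivity, h1⟩
    simp [fractInvCut, h, h1.le, h2]

/-- The Mellin transform of the fractional part of `1 / v` in the critical strip. -/
theorem hasMellin_fract_inv {s : ℂ} (hs : 0 < s.re) (hs1 : s.re < 1) :
    HasMellin (fun v : ℝ => ((Int.fract v⁻¹ : ℝ) : ℂ)) s (-riemannZeta s / s) := by
  have hs1' : s - 1 ≠ 0 := by
    intro h
    have := congrArg Complex.re h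
    simp at this; linarith
  have hs0 : s ≠ 0 := by rintro rfl; simp at hs
  have hcpow : ∀ t : ℝ, (t : ℂ) ^ (s - 1) • (Ioi (1 : ℝ)).indicator (fun u : ℝ => (u : ℂ)⁻¹) t
      = (Ioi (1 : ℝ)).indicator (fun u : ℝ => (u : ℂ) ^ (s - 2)) t := fun t => by
    by_cases ht : t ∈ Ioi (1 : ℝ)
    · have ht0 : (t : ℂ) ≠ 0 := by exact_mod_cast (one_pos.trans (mem_Ioi.1 ht)).ne'
      simp only [ht, indicator_of_mem, smul_eq_mul]
      rw [show s - 1 = s - 2 + 1 by ring, Complex.cpow_add _ _ ht0, Complex.cpow_one]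
      field_simp
    · simp [ht]
  have hint : Ioi (0 : ℝ) ∩ Ioi 1 = Ioi 1 := by
    ext u; simp only [mem_inter_iff, mem_Ioi]
    exact ⟨fun h => h.2, fun h => ⟨by linarith, h⟩⟩
  have hlt : (s - 2).re < -1 := by simp; linarith
  have hm : MellinConvergent ((Ioi (1 : ℝ)).indicator (fun u : ℝ => (u : ℂ)⁻¹)) s := by
    unfold MellinConvergent
    simp_rw [hcpow]
    rw [integrableOn_indicator_iff measurableSet_Ioi, inter_comm, hint]
    exact integrableOn_Ioi_cpow_of_lt hlt one_pos
  have hv : mellin ((Ioi (1 : ℝ)).indicator (fun u : ℝ => (u : ℂ)⁻¹)) s = -1 / (s - 1) := by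
    unfold mellin
    simp_rw [hcpow]
    rw [setIntegral_indicator measurableSet_Ioi, hint, integral_Ioi_cpow_of_lt hlt one_pos]
    simp only [Complex.ofReal_one, Complex.one_cpow]
    congr 1; ring
  have h := hasMellin_add (mellinConvergent_fractInvCut hs) hm
  have hcongr : ∀ t ∈ Ioi (0 : ℝ), (t : ℂ) ^ (s - 1) • (fractInvCut t +
      (Ioi (1 : ℝ)).indicator (fun u : ℝ => (u : ℂ)⁻¹) t) =
      (t : ℂ) ^ (s - 1) • ((Int.fract t⁻¹ : ℝ) : ℂ) := fun t ht => by
    rw [fract_inv_eq ht]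
  refine ⟨IntegrableOn.congr_fun h.1 hcongr measurableSet_Ioi, ?_⟩
  have h2 : mellin (fun v : ℝ => ((Int.fract v⁻¹ : ℝ) : ℂ)) s = _ :=
    (setIntegral_congr_fun measurableSet_Ioi hcongr).symm.trans h.2
  rw [h2, hv]
  have h3 := sub_one_mul_riemannZeta_eq hs (sub_ne_zero.1 hs1')
  field_simp
  linear_combination h3

/-! ### Entire functions with exponential decay: Mellin transforms and Euler-Maclaurin summation. -/

/-- Entire functions that decay like `exp (-Re z)` on every right half-strip
`|Im z| ≤ K`, `Re z ≥ -K`. -/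
def StripDecay (f : ℂ → ℂ) : Prop :=
  Differentiable ℂ f ∧ ∀ K : ℝ, ∃ C : ℝ, ∀ z : ℂ, |z.im| ≤ K → -K ≤ z.re →
    ‖f z‖ ≤ C * Real.exp (-z.re)

namespace StripDecay

variable {f : ℂ → ℂ}

/-- Cauchy's estimate on unit circles, which stay in the strip for `K + 1` and cost a factor `e`.
Strips around the half line, for every `K`, are required for this closure property. -/
theorem deriv (hf : StripDecay f) : StripDecay (deriv f) := by
  refine ⟨hf.1.deriv, fun K => ?_⟩
  obtain ⟨C, hC⟩ := hf.2 (K + 1)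
  refine ⟨|C| * Real.exp 1, fun z hz1 hz2 => ?_⟩
  have h := Complex.norm_deriv_le_of_forall_mem_sphere_norm_le (c := z) (R := 1) (f := f)
    (C := |C| * Real.exp 1 * Real.exp (-z.re)) one_pos hf.1.diffContOnCl (fun w hw => ?_)
  · simpa using h
  have hw' : ‖w - z‖ = 1 := by simpa using hw
  have hre : |w.re - z.re| ≤ 1 := by
    rw [← hw', ← Complex.sub_re]; exact Complex.abs_re_le_norm _
  have him : |w.im - z.im| ≤ 1 := by
    rw [← hw', ← Complex.sub_im]; exact Complex.abs_im_le_norm _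
  rw [abs_le] at hre him hz1
  refine (hC w (abs_le.2 ⟨by linarith, by linarith⟩) (by linarith)).trans ?_
  rw [mul_assoc, ← Real.exp_add]
  refine mul_le_mul (le_abs_self C) (Real.exp_le_exp.2 (by linarith)) (Real.exp_pos _).le
    (abs_nonneg C)

theorem exists_bound (hf : StripDecay f) :
    ∃ C : ℝ, 0 ≤ C ∧ ∀ u : ℝ, 0 ≤ u → ‖f u‖ ≤ C * Real.exp (-u) := by
  obtain ⟨C, hC⟩ := hf.2 0
  refine ⟨|C|, abs_nonneg C, fun u hu => ?_⟩
  refine (hC u (by simp) (by simpa using hu)).trans ?_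
  simpa using mul_le_mul_of_nonneg_right (le_abs_self C) (Real.exp_pos _).le

theorem continuous_ofReal (hf : StripDecay f) : Continuous fun u : ℝ => f u :=
  hf.1.continuous.comp Complex.continuous_ofReal

theorem hasDerivAt_ofReal (hf : StripDecay f) (u : ℝ) :
    HasDerivAt (fun u : ℝ => f u) (_root_.deriv f u) u :=
  (hf.1 u).hasDerivAt.comp_ofReal

theorem mellinConvergent (hf : StripDecay f) {s : ℂ} (hs : 0 < s.re) :
    MellinConvergent (fun u : ℝ => f u) s := by
  obtain ⟨C, hC0, hC⟩ := hf.exists_bound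
  refine mellinConvergent_of_isBigO_rpow_exp (a := 1) (b := 0) one_pos
    (hf.continuous_ofReal.locallyIntegrable.locallyIntegrableOn _) ?_ ?_ hs
  · refine Asymptotics.IsBigO.of_bound C ?_
    filter_upwards [eventually_ge_atTop (0 : ℝ)] with u hu
    simpa [Real.norm_of_nonneg (Real.exp_pos _).le] using hC u hu
  · refine Asymptotics.IsBigO.of_bound C ?_
    filter_upwards [self_mem_nhdsWithin] with u hu
    refine (hC u (le_of_lt hu)).trans ?_
    simp only [neg_zero, Real.rpow_zero, norm_one]
    exact mul_le_mul_of_nonneg_left (Real.exp_le_one_iff.2 (neg_nonpos.2 (le_of_lt hu))) hC0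

theorem integrableOn (hf : StripDecay f) : IntegrableOn (fun u : ℝ => f u) (Ioi 0) := by
  simpa [MellinConvergent] using hf.mellinConvergent (s := 1) (by simp)

theorem mellin_one (f : ℂ → ℂ) : mellin (fun u : ℝ => f u) 1 = ∫ u in Ioi (0 : ℝ), f u := by
  simp [mellin]

/-- Integration by parts; `u ^ s * f u` vanishes at 0 because `Re s > 0` and at infinity by decay.
-/
theorem mellin_deriv (hf : StripDecay f) {s : ℂ} (hs : 0 < s.re) :
    mellin (fun u : ℝ => _root_.deriv f u) (s + 1) = -s * mellin (fun u : ℝ => f u) s := by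
  obtain ⟨C, hC0, hC⟩ := hf.exists_bound
  have hs0 : s ≠ 0 := by rintro rfl; simp at hs
  have h1 := hf.deriv.mellinConvergent (s := s + 1) (by simp; linarith)
  have h2 := hf.mellinConvergent hs
  unfold MellinConvergent at h1 h2
  have hnorm : ∀ u : ℝ, 0 < u → ‖(u : ℂ) ^ s * f u‖ ≤ C * (u ^ s.re * Real.exp (-u)) := by
    intro u hu
    rw [norm_mul, Complex.norm_cpow_eq_rpow_re_of_pos hu]
    calc u ^ s.re * ‖f u‖ ≤ u ^ s.re * (C * Real.exp (-u)) :=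
          mul_le_mul_of_nonneg_left (hC u hu.le) (Real.rpow_nonneg hu.le _)
      _ = _ := by ring
  have h := integral_Ioi_mul_deriv_eq_deriv_mul (a := 0) (a' := (0 : ℂ)) (b' := 0)
    (u := fun u : ℝ => (u : ℂ) ^ s) (v := fun u : ℝ => f u)
    (u' := fun u : ℝ => s * (u : ℂ) ^ (s - 1)) (v' := fun u : ℝ => _root_.deriv f u)
    (fun u hu => ?_) (fun u _ => hf.hasDerivAt_ofReal u) ?_ ?_ ?_ ?_
  · simp only [mellin, smul_eq_mul, add_sub_cancel_right]
    rw [h]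
    simp only [mul_assoc, integral_const_mul]
    ring
  · have := (Complex.hasStrictDerivAt_cpow_const (c := s) (x := (u : ℂ))
      (Or.inl (by simpa using hu))).hasDerivAt.comp_ofReal
    simpa using this
  · simpa [Pi.mul_def] using h1
  · have : IntegrableOn (fun u : ℝ => s * ((u : ℂ) ^ (s - 1) * f u)) (Ioi 0) :=
      Integrable.const_mul h2 s
    refine this.congr_fun (fun u _ => ?_) measurableSet_Ioi
    simp [mul_assoc]
  · refine squeeze_zero_norm' (a := fun u : ℝ => C * (u ^ s.re * Real.exp (-u))) ?_ ?_
    · filter_upwards [self_mem_nhdsWithin] with u hu using hnorm u hu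
    · have hc : ContinuousAt (fun u : ℝ => C * (u ^ s.re * Real.exp (-u))) 0 :=
        continuousAt_const.mul ((Real.continuousAt_rpow_const 0 s.re (Or.inr hs.le)).mul
          (by fun_prop))
      have := hc.tendsto.mono_left (nhdsWithin_le_nhds (s := Ioi (0 : ℝ)))
      simpa [Real.zero_rpow hs.ne'] using this
  · refine squeeze_zero_norm' (a := fun u : ℝ => C * (u ^ s.re * Real.exp (-u))) ?_ ?_
    · filter_upwards [eventually_gt_atTop (0 : ℝ)] with u hu using hnorm u hu
    · have := tendsto_rpow_mul_exp_neg_mul_atTop_nhds_zero s.re 1 one_pos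
      simpa using this.const_mul C

/-- A divergent integral has the value 0, so no convergence hypothesis is needed. -/
theorem exists_norm_mellin_le (f : ℂ → ℂ) (σ : ℝ) :
    ∃ C : ℝ, 0 ≤ C ∧ ∀ s : ℂ, s.re = σ → ‖mellin (fun u : ℝ => f u) s‖ ≤ C := by
  refine ⟨∫ u in Ioi (0 : ℝ), u ^ (σ - 1) * ‖f u‖, ?_, fun s hs => ?_⟩
  · exact setIntegral_nonneg measurableSet_Ioi fun u hu =>
      mul_nonneg (Real.rpow_nonneg (le_of_lt hu) _) (norm_nonneg _)
  · refine (norm_integral_le_integral_norm _).trans (le_of_eq ?_)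
    refine setIntegral_congr_fun measurableSet_Ioi fun u hu => ?_
    simp [Complex.norm_cpow_eq_rpow_re_of_pos hu, hs]

/-- Two applications of `mellin_deriv` express `s (s + 1)` times the transform as the transform of
`f''`, bounded on vertical lines; `σ ≥ 1` gives `|s| |s + 1| ≥ 1 + (Im s)²`. -/
theorem exists_norm_mellin_le_div (hf : StripDecay f) {σ : ℝ} (hσ : 1 ≤ σ) :
    ∃ C : ℝ, 0 ≤ C ∧ ∀ s : ℂ, s.re = σ →
      ‖mellin (fun u : ℝ => f u) s‖ ≤ C / (1 + s.im ^ 2) := by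
  obtain ⟨C, hC0, hC⟩ := exists_norm_mellin_le (_root_.deriv (_root_.deriv f)) (σ + 2)
  refine ⟨C, hC0, fun s hs => ?_⟩
  have h1 := hf.mellin_deriv (s := s) (by linarith)
  have h2 := hf.deriv.mellin_deriv (s := s + 1) (by simp; linarith)
  rw [h1] at h2
  have h3 := hC (s + 1 + 1) (by simp [hs]; ring)
  rw [h2, norm_mul, norm_mul, norm_neg, norm_neg] at h3
  have key : ∀ z : ℂ, 1 ≤ z.re → z.im = s.im → Real.sqrt (1 + s.im ^ 2) ≤ ‖z‖ := by
    intro z hz hzi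
    rw [Complex.norm_eq_sqrt_sq_add_sq, hzi]
    exact Real.sqrt_le_sqrt (by nlinarith)
  have k1 := key s (hs ▸ hσ) rfl
  have k2 := key (s + 1) (by simp; linarith) (by simp)
  have hp : 0 < 1 + s.im ^ 2 := by positivity
  rw [le_div_iff₀ hp]
  refine le_trans ?_ h3
  have hs2 : 1 + s.im ^ 2 ≤ ‖s + 1‖ * ‖s‖ := by
    calc 1 + s.im ^ 2 = Real.sqrt (1 + s.im ^ 2) * Real.sqrt (1 + s.im ^ 2) :=
          (Real.mul_self_sqrt hp.le).symm
      _ ≤ _ := mul_le_mul k2 k1 (Real.sqrt_nonneg _) (norm_nonneg _)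
  calc _ ≤ ‖mellin (fun u : ℝ => f u) s‖ * (‖s + 1‖ * ‖s‖) :=
        mul_le_mul_of_nonneg_left hs2 (norm_nonneg _)
    _ = _ := by ring

theorem summable (hf : StripDecay f) {y : ℝ} (hy : 0 < y) :
    Summable fun n : ℕ => f (((n + 1 : ℝ) * y : ℝ)) := by
  obtain ⟨C, hC0, hC⟩ := hf.exists_bound
  have hg : Summable fun n : ℕ => C * Real.exp (-y) ^ n :=
    (summable_geometric_of_lt_one (Real.exp_pos _).le (by simpa using hy)).mul_left C
  refine hg.of_norm_bounded fun n => (hC _ (by positivity)).trans ?_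
  rw [← Real.exp_nat_mul]
  refine mul_le_mul_of_nonneg_left (Real.exp_le_exp.2 ?_) hC0
  nlinarith

theorem interval_deriv_mul_fract (hf : StripDecay f) {y : ℝ} (hy : 0 < y) (n : ℕ) :
    ∫ u in ((n : ℝ) * y)..((n + 1 : ℕ) * y), _root_.deriv f u * ((Int.fract (u / y) : ℝ) : ℂ) =
      f (((n + 1 : ℝ) * y : ℝ)) - (y : ℂ)⁻¹ * ∫ u in ((n : ℝ) * y)..((n + 1 : ℕ) * y), f u := by
  have hle : (n : ℝ) * y ≤ (n + 1 : ℕ) * y := by push_cast; nlinarith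
  have hyc : (y : ℂ) ≠ 0 := by exact_mod_cast hy.ne'
  have h1 : ∫ u in ((n : ℝ) * y)..((n + 1 : ℕ) * y),
      _root_.deriv f u * ((Int.fract (u / y) : ℝ) : ℂ) =
      ∫ u in ((n : ℝ) * y)..((n + 1 : ℕ) * y), ((u : ℂ) / y - n) * _root_.deriv f u := by
    -- The open interval avoids the right endpoint, where the fractional part jumps to 0.
    rw [intervalIntegral.integral_of_le hle, intervalIntegral.integral_of_le hle,
      integral_Ioc_eq_integral_Ioo, integral_Ioc_eq_integral_Ioo]
    refine setIntegral_congr_fun measurableSet_Ioo fun u hu => ?_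
    have hfl : ⌊u / y⌋ = (n : ℤ) := by
      rw [Int.floor_eq_iff]
      push_cast
      rw [le_div_iff₀ hy, div_lt_iff₀ hy]
      have := hu.2
      push_cast at this
      exact ⟨hu.1.le, this⟩
    simp only [Int.fract, hfl]
    push_cast
    ring
  have h2 := intervalIntegral.integral_mul_deriv_eq_deriv_mul
    (u := fun u : ℝ => (u : ℂ) / y - n) (u' := fun _ => (y : ℂ)⁻¹)
    (v := fun u : ℝ => f u) (v' := fun u : ℝ => _root_.deriv f u)
    (a := (n : ℝ) * y) (b := (n + 1 : ℕ) * y)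
    (fun u _ => by
      have := ((Complex.ofRealCLM.hasDerivAt (x := u)).div_const (y : ℂ)).sub_const (n : ℂ)
      simpa using this)
    (fun u _ => hf.hasDerivAt_ofReal u) (by simp)
    (hf.deriv.continuous_ofReal.intervalIntegrable _ _)
  rw [h1, h2, intervalIntegral.integral_const_mul]
  push_cast
  field_simp
  ring

/-- First order Euler-Maclaurin summation on the half line with step `y`. -/
theorem tsum_sub_integral (hf : StripDecay f) {y : ℝ} (hy : 0 < y) :
    ∑' n : ℕ, f (((n + 1 : ℝ) * y : ℝ)) - (y : ℂ)⁻¹ * ∫ u in Ioi (0 : ℝ), f u =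
      ∫ u in Ioi (0 : ℝ), _root_.deriv f u * ((Int.fract (u / y) : ℝ) : ℂ) := by
  have hI : IntegrableOn (fun u : ℝ => _root_.deriv f u * ((Int.fract (u / y) : ℝ) : ℂ))
      (Ioi 0) := by
    refine hf.deriv.integrableOn.mul_bdd (c := 1) ?_ (ae_of_all _ fun u => norm_fract_le_one _)
    exact (Complex.measurable_ofReal.comp
      (measurable_fract.comp (measurable_id.div_const y))).aestronglyMeasurable
  have hb : Tendsto (fun n : ℕ => (n : ℝ) * y) atTop atTop :=
    tendsto_natCast_atTop_atTop.atTop_mul_const hy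
  have t1 := intervalIntegral_tendsto_integral_Ioi 0 hI hb
  have t2 := intervalIntegral_tendsto_integral_Ioi 0 hf.integrableOn hb
  have t3 := (hf.summable hy).hasSum.tendsto_sum_nat
  -- Both sides are limits of their truncations at `n * y`, which agree interval by interval.
  refine tendsto_nhds_unique (t3.sub (t2.const_mul (y : ℂ)⁻¹)) (t1.congr fun n => ?_)
  have e1 := intervalIntegral.sum_integral_adjacent_intervals (n := n) (μ := volume)
    (f := fun u : ℝ => _root_.deriv f u * ((Int.fract (u / y) : ℝ) : ℂ))
    (a := fun k : ℕ => (k : ℝ) * y) (fun k _ => by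
      rw [intervalIntegrable_iff_integrableOn_Ioc_of_le (by push_cast; nlinarith)]
      exact hI.mono_set fun u hu => lt_of_le_of_lt (by positivity) hu.1)
  have e2 := intervalIntegral.sum_integral_adjacent_intervals (n := n) (μ := volume)
    (f := fun u : ℝ => f u)
    (a := fun k : ℕ => (k : ℝ) * y) (fun k _ => hf.continuous_ofReal.intervalIntegrable _ _)
  simp only [Nat.cast_zero, zero_mul] at e1 e2
  rw [← e1, ← e2, Finset.mul_sum, ← Finset.sum_sub_distrib]
  exact Finset.sum_congr rfl fun k _ => hf.interval_deriv_mul_fract hy k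

end StripDecay

/-! ### Logarithmic coordinates and Parseval's formula. -/

/-- The function `g` on `(0, ∞)` in logarithmic coordinates, with weight `σ`. -/
def logScale (σ : ℝ) (g : ℝ → ℂ) (u : ℝ) : ℂ := (Real.exp (-σ * u) : ℂ) * g (Real.exp (-u))

theorem fourier_logScale (σ : ℝ) (g : ℝ → ℂ) (ξ : ℝ) :
    𝓕 (logScale σ g) ξ = mellin g (σ + 2 * π * ξ * Complex.I) := by
  rw [mellin_eq_fourier]
  have h1 : (σ + 2 * π * ξ * Complex.I : ℂ).re = σ := by simp
  have h2 : (σ + 2 * π * ξ * Complex.I : ℂ).im = 2 * π * ξ := by simp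
  rw [h1, h2, mul_div_cancel_left₀ _ (by positivity)]
  rfl

theorem exp_neg_image_univ : (fun u : ℝ => Real.exp (-u)) '' univ = Ioi 0 := by
  ext y
  simp only [image_univ, mem_range, mem_Ioi]
  exact ⟨fun ⟨u, hu⟩ => hu ▸ Real.exp_pos _, fun h => ⟨-Real.log y, by simp [Real.exp_log h]⟩⟩

theorem integrableOn_Ioi_iff_logScale (g : ℝ → ℂ) :
    IntegrableOn g (Ioi 0) ↔ Integrable (logScale 1 g) := by
  have h := integrableOn_image_iff_integrableOn_abs_deriv_smul (s := univ)
    (f := fun u : ℝ => Real.exp (-u)) (f' := fun u => -Real.exp (-u)) MeasurableSet.univ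
    (fun u _ =>
      ((hasDerivAt_neg u).exp.congr_deriv (by simp)).hasDerivWithinAt)
    (Real.exp_injective.comp neg_injective).injOn g
  rw [exp_neg_image_univ] at h
  rw [h, integrableOn_univ]
  refine iff_of_eq (congrArg (fun F : ℝ → ℂ => Integrable F volume) ?_)
  ext u
  simp [logScale, abs_of_pos (Real.exp_pos _)]

theorem integral_Ioi_eq_logScale (g : ℝ → ℂ) :
    ∫ y in Ioi (0 : ℝ), g y = ∫ u, logScale 1 g u := by
  have h := fourier_logScale 1 g 0
  rw [Real.fourier_real_eq] at h
  simpa [mellin] using h.symm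

theorem logScale_cpow (σ : ℝ) (g : ℝ → ℂ) :
    logScale 1 (fun t => (t : ℂ) ^ ((σ : ℂ) - 1) • g t) = logScale σ g := by
  ext u
  simp only [logScale, smul_eq_mul]
  rw [← mul_assoc]
  congr 1
  have : ((σ : ℂ) - 1) = ((σ - 1 : ℝ) : ℂ) := by push_cast; rfl
  rw [this, ← Complex.ofReal_cpow (Real.exp_pos _).le, ← Complex.ofReal_mul, ← Real.exp_mul,
    ← Real.exp_add]
  congr 2; ring

theorem integrable_logScale_iff (σ : ℝ) (g : ℝ → ℂ) :
    Integrable (logScale σ g) ↔ MellinConvergent g σ := by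
  rw [MellinConvergent, integrableOn_Ioi_iff_logScale, logScale_cpow]

/-- Dilation becomes translation. Sharing the Jacobian `e^{-u}` equally between the two factors
leaves `e^{x/2}`, the source of the prefactor `e^{-x/2}` in the theorem. -/
theorem logScale_mul_comp (g : ℝ → ℂ) (x : ℝ) :
    logScale 1 (fun y => g (y * Real.exp (-x)) * g y) =
      fun u => (Real.exp (x / 2) : ℂ) * (logScale (1 / 2) g u * logScale (1 / 2) g (u + x)) := by
  ext u
  simp only [logScale]
  rw [← Real.exp_add, show -u + -x = -(u + x) by ring]
  have : (Real.exp (-1 * u) : ℂ) = Real.exp (x / 2) * (Real.exp (-(1 / 2) * u) *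
      Real.exp (-(1 / 2) * (u + x))) := by
    rw [← Complex.ofReal_mul, ← Complex.ofReal_mul, ← Real.exp_add, ← Real.exp_add]
    congr 2; ring
  rw [this]; ring

theorem continuous_fourier_of_integrable {h : ℝ → ℂ} (hi : Integrable h) : Continuous (𝓕 h) :=
  VectorFourier.fourierIntegral_continuous Real.continuous_fourierChar
    (innerSL ℝ).continuous₂ hi

theorem norm_fourier_le_integral_norm (h : ℝ → ℂ) (ξ : ℝ) : ‖𝓕 h ξ‖ ≤ ∫ v, ‖h v‖ :=
  VectorFourier.norm_fourierIntegral_le_integral_norm _ _ _ _ _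

/-- Parseval's formula for the correlation of an integrable function with itself. -/
theorem integral_mul_shift_eq_integral_fourier {h : ℝ → ℂ} (hc : Continuous h)
    (hi : Integrable h) (hF : Integrable (𝓕 h)) (x : ℝ) :
    ∫ v, h v * h (v + x) =
      ∫ ξ, 𝓕 h ξ * (𝓕 h (-ξ) * Complex.exp (((-2 * π * x * ξ : ℝ) : ℂ) * Complex.I)) := by
  -- By Fourier inversion `𝓕 g` is the translate of `h` by `x`, so the claim reduces to `∫ 𝓕 h * g =
  -- ∫ h * 𝓕 g`.
  set g : ℝ → ℂ := fun ξ => 𝓕 h (-ξ) * Complex.exp (((-2 * π * x * ξ : ℝ) : ℂ) * Complex.I)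
    with hg
  have hgi : Integrable g := by
    refine hF.comp_neg.mul_bdd (c := 1) (by fun_prop) (ae_of_all _ fun ξ => ?_)
    rw [Complex.norm_exp_ofReal_mul_I]
  have hgF : ∀ v, 𝓕 g v = h (v + x) := fun v => by
    have hinv := congrFun (hc.fourierInv_fourier_eq hi hF) (v + x)
    rw [← hinv, Real.fourierInv_eq', Real.fourier_eq', ← integral_neg_eq_self]
    refine integral_congr_ae (ae_of_all _ fun ξ => ?_)
    simp only [hg, smul_eq_mul, neg_neg]
    rw [mul_left_comm, mul_comm, ← Complex.exp_add]
    congr 2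
    simp
    ring
  have key : ∫ ξ, 𝓕 h ξ • g ξ = ∫ v, h v • 𝓕 g v := by
    simpa using! (VectorFourier.integral_fourierIntegral_smul_eq_flip (L := innerₗ ℝ)
      Real.continuous_fourierChar continuous_inner hi hgi)
  simp only [smul_eq_mul, hgF] at key
  exact key.symm

/-- By inversion `h` is bounded by the `L¹` norm of `𝓕 h`. -/
theorem integrable_mul_shift {h : ℝ → ℂ} (hc : Continuous h)
    (hi : Integrable h) (hF : Integrable (𝓕 h)) (x : ℝ) :
    Integrable fun v => h v * h (v + x) := by
  refine hi.mul_bdd (c := ∫ ξ, ‖𝓕 h ξ‖) (by fun_prop) (ae_of_all _ fun v => ?_)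
  rw [← congrFun (hc.fourierInv_fourier_eq hi hF) (v + x), Real.fourierInv_eq_fourier_neg]
  exact norm_fourier_le_integral_norm _ _

/-! ### Müntz's formula on the critical line. -/

/-- The sum of `f` over the positive multiples of `y`, minus its expected size. -/
def thetaDefect (f : ℂ → ℂ) (y : ℝ) : ℂ :=
  ∑' n : ℕ, f (((n + 1 : ℝ) * y : ℝ)) - (y : ℂ)⁻¹ * ∫ u in Ioi (0 : ℝ), f u

namespace StripDecay

variable {f : ℂ → ℂ}

/-- This is `∫ f'(u) {u/y} du` with `u = e^{-w}`, `y = e^{-v}`; the weights match because `v/2 + w =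
3w/2 + (v - w)/2`. -/
theorem logScale_thetaDefect (hf : StripDecay f) :
    logScale (1 / 2) (thetaDefect f) =
      convolution (logScale (3 / 2) fun u => _root_.deriv f u)
        (logScale (1 / 2) fun v => ((Int.fract v⁻¹ : ℝ) : ℂ)) (ContinuousLinearMap.mul ℂ ℂ)
        volume := by
  ext v
  rw [logScale, thetaDefect, hf.tsum_sub_integral (Real.exp_pos _), integral_Ioi_eq_logScale,
    convolution, ← integral_const_mul]
  refine integral_congr_ae (ae_of_all _ fun w => ?_)
  simp only [logScale, ContinuousLinearMap.mul_apply']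
  have e1 : Real.exp (-w) / Real.exp (-v) = (Real.exp (-(v - w)))⁻¹ := by
    rw [← Real.exp_sub, ← Real.exp_neg]; congr 1; ring
  have e2 : (Real.exp (-(1 / 2) * v) : ℂ) * Real.exp (-1 * w) =
      Real.exp (-(3 / 2) * w) * Real.exp (-(1 / 2) * (v - w)) := by
    rw [← Complex.ofReal_mul, ← Complex.ofReal_mul, ← Real.exp_add, ← Real.exp_add]
    congr 2; ring
  rw [e1]
  linear_combination (_root_.deriv f (Real.exp (-w)) *
    ((Int.fract (Real.exp (-(v - w)))⁻¹ : ℝ) : ℂ)) * e2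

theorem integrable_logScale (hf : StripDecay f) {σ : ℝ} (hσ : 0 < σ) :
    Integrable (logScale σ fun u => f u) :=
  (integrable_logScale_iff _ _).2 (hf.mellinConvergent (by simpa using hσ))

theorem bddAbove_logScale (hf : StripDecay f) :
    BddAbove (range fun w => ‖logScale (3 / 2) (fun u => f u) w‖) := by
  obtain ⟨C, hC0, hC⟩ := hf.exists_bound
  refine ⟨C * 2, ?_⟩
  rintro _ ⟨w, rfl⟩
  simp only [logScale, norm_mul, Complex.norm_real, Real.norm_eq_abs, Real.abs_exp]
  have hu := Real.exp_pos (-w)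
  set u := Real.exp (-w) with hu'
  -- With `u = e^{-w}`, the first factor is at most 1 for `w ≥ 0` and at most `u² ≤ 2 e^u` for `w ≤
  -- 0`.
  have h1 : Real.exp (-(3 / 2) * w) * Real.exp (-u) ≤ 2 := by
    have hE := Real.quadratic_le_exp_of_nonneg hu.le
    have h2 : Real.exp (-(3 / 2) * w) ≤ 2 * Real.exp u := by
      rcases le_total 0 w with hw | hw
      · have : Real.exp (-(3 / 2) * w) ≤ 1 := Real.exp_le_one_iff.2 (by linarith)
        nlinarith
      · have : Real.exp (-(3 / 2) * w) ≤ u ^ 2 := by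
          rw [hu', ← Real.exp_nat_mul]
          exact Real.exp_le_exp.2 (by push_cast; linarith)
        nlinarith
    calc _ ≤ 2 * Real.exp u * Real.exp (-u) :=
          mul_le_mul_of_nonneg_right h2 (Real.exp_pos _).le
      _ = 2 := by rw [mul_assoc, ← Real.exp_add]; simp
  calc _ ≤ Real.exp (-(3 / 2) * w) * (C * Real.exp (-u)) :=
        mul_le_mul_of_nonneg_left (hC u hu.le) (Real.exp_pos _).le
    _ = C * (Real.exp (-(3 / 2) * w) * Real.exp (-u)) := by ring
    _ ≤ C * 2 := mul_le_mul_of_nonneg_left h1 hC0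

theorem continuous_logScale (hf : StripDecay f) (σ : ℝ) :
    Continuous (logScale σ fun u => f u) := by
  have := hf.1.continuous
  unfold logScale
  fun_prop

theorem integrable_logScale_fract_inv :
    Integrable (logScale (1 / 2) fun v => ((Int.fract v⁻¹ : ℝ) : ℂ)) := by
  rw [integrable_logScale_iff]
  exact (hasMellin_fract_inv (by simp) (by norm_num)).1

theorem continuous_logScale_thetaDefect (hf : StripDecay f) :
    Continuous (logScale (1 / 2) (thetaDefect f)) := by
  rw [hf.logScale_thetaDefect]
  exact hf.deriv.bddAbove_logScale.continuous_convolution_left_of_integrable _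
    (hf.deriv.continuous_logScale _) integrable_logScale_fract_inv

theorem integrable_logScale_thetaDefect (hf : StripDecay f) :
    Integrable (logScale (1 / 2) (thetaDefect f)) := by
  rw [hf.logScale_thetaDefect]
  exact (hf.deriv.integrable_logScale (by norm_num)).integrable_convolution _
    integrable_logScale_fract_inv

theorem fourier_logScale_thetaDefect_eq_mul (hf : StripDecay f) (ξ : ℝ) :
    𝓕 (logScale (1 / 2) (thetaDefect f)) ξ =
      𝓕 (logScale (3 / 2) fun u => _root_.deriv f u) ξ *
        𝓕 (logScale (1 / 2) fun v => ((Int.fract v⁻¹ : ℝ) : ℂ)) ξ := by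
  rw [hf.logScale_thetaDefect]
  exact Real.fourier_mul_convolution_eq (hf.deriv.integrable_logScale (by norm_num))
    integrable_logScale_fract_inv ξ

/-- Müntz's formula on the critical line. -/
theorem fourier_logScale_thetaDefect (hf : StripDecay f) (ξ : ℝ) :
    𝓕 (logScale (1 / 2) (thetaDefect f)) ξ =
      riemannZeta (1 / 2 + 2 * π * ξ * Complex.I) *
        mellin (fun u : ℝ => f u) (1 / 2 + 2 * π * ξ * Complex.I) := by
  rw [hf.fourier_logScale_thetaDefect_eq_mul, fourier_logScale, fourier_logScale]
  set s : ℂ := 1 / 2 + 2 * π * ξ * Complex.I with hs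
  have hre : s.re = 1 / 2 := by simp [hs]
  have hs0 : s ≠ 0 := by intro h; rw [h] at hre; norm_num at hre
  have e1 : ((3 / 2 : ℝ) : ℂ) + 2 * π * ξ * Complex.I = s + 1 := by
    rw [hs]; push_cast; ring
  have e2 : ((1 / 2 : ℝ) : ℂ) + 2 * π * ξ * Complex.I = s := by
    rw [hs]; push_cast; ring
  rw [e1, e2, hf.mellin_deriv (by rw [hre]; norm_num),
    (hasMellin_fract_inv (by rw [hre]; norm_num) (by rw [hre]; norm_num)).2]
  field_simp

/-- Keeping the convolution factors avoids any growth bound for zeta: the factor from `f'` on `Re s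
= 3/2` decays quadratically, and the other is bounded as the Fourier transform of an integrable
function. -/
theorem integrable_fourier_logScale_thetaDefect (hf : StripDecay f) :
    Integrable (𝓕 (logScale (1 / 2) (thetaDefect f))) := by
  obtain ⟨C, hC0, hC⟩ := hf.deriv.exists_norm_mellin_le_div (σ := 3 / 2) (by norm_num)
  set D := ∫ v, ‖logScale (1 / 2) (fun v => ((Int.fract v⁻¹ : ℝ) : ℂ)) v‖ with hD
  have hint : Integrable fun ξ : ℝ => C * (1 + (2 * π * ξ) ^ 2)⁻¹ * D :=
    ((integrable_inv_one_add_sq.comp_mul_left' (R := 2 * π) (by positivity)).const_mul C).mul_const D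
  refine hint.mono'
    (continuous_fourier_of_integrable hf.integrable_logScale_thetaDefect).aestronglyMeasurable
    (ae_of_all _ fun ξ => ?_)
  rw [hf.fourier_logScale_thetaDefect_eq_mul, norm_mul]
  refine mul_le_mul ?_ (norm_fourier_le_integral_norm _ _) (norm_nonneg _) (by positivity)
  rw [fourier_logScale]
  simpa [div_eq_mul_inv] using hC ((3 / 2 : ℝ) + 2 * π * ξ * Complex.I) (by simp)

end StripDecay

/-! ### Mellin transform of the Gaussian-Bessel function. -/

theorem norm_cexp_neg_mul_ofReal (t : ℂ) (v : ℝ) :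
    ‖Complex.exp (-t * v)‖ = Real.exp (-t.re * v) := by
  rw [Complex.norm_exp]; simp

theorem integrableOn_rpow_mul_exp_neg {α b : ℝ} (hα : -1 < α) (hb : 0 < b) :
    IntegrableOn (fun v : ℝ => v ^ α * Real.exp (-b * v)) (Ioi 0) := by
  simpa using integrableOn_rpow_mul_exp_neg_mul_rpow hα one_pos hb

theorem differentiableAt_mellin_exp_neg_mul {t a : ℂ} (ht : 0 < t.re) (ha : 0 < a.re) :
    DifferentiableAt ℂ (fun t : ℂ => mellin (fun v : ℝ => Complex.exp (-t * v)) a) t := by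
  have hs : {z : ℂ | t.re / 2 < z.re} ∈ 𝓝 t :=
    (isOpen_lt continuous_const Complex.continuous_re).mem_nhds
      (show t.re / 2 < t.re by linarith)
  have hmeas : ∀ z : ℂ, AEStronglyMeasurable (fun v : ℝ => (v : ℂ) ^ (a - 1) • Complex.exp (-z * v))
      (volume.restrict (Ioi 0)) := fun z =>
    ((Complex.measurable_ofReal.pow_const _).smul (by fun_prop)).aestronglyMeasurable
  have h := hasDerivAt_integral_of_dominated_loc_of_deriv_le (μ := volume.restrict (Ioi (0 : ℝ)))
    (F := fun (z : ℂ) (v : ℝ) => (v : ℂ) ^ (a - 1) • Complex.exp (-z * v))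
    (F' := fun (z : ℂ) (v : ℝ) => (v : ℂ) ^ (a - 1) • (Complex.exp (-z * v) * (-v)))
    (bound := fun v => v ^ a.re * Real.exp (-(t.re / 2) * v)) hs
    (Eventually.of_forall hmeas) ?_ ?_ ?_ ?_ ?_
  · exact h.2.differentiableAt
  · refine (integrableOn_rpow_mul_exp_neg (α := a.re - 1) (by linarith) ht).mono' (hmeas t) ?_
    filter_upwards [ae_restrict_mem measurableSet_Ioi] with v hv
    rw [norm_smul, Complex.norm_cpow_eq_rpow_re_of_pos hv, norm_cexp_neg_mul_ofReal]
    simp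
  · exact ((Complex.measurable_ofReal.pow_const _).smul (by fun_prop)).aestronglyMeasurable
  · filter_upwards [ae_restrict_mem measurableSet_Ioi] with v hv z hz
    have hv' : (0 : ℝ) < v := hv
    rw [norm_smul, norm_mul, Complex.norm_cpow_eq_rpow_re_of_pos hv, norm_cexp_neg_mul_ofReal,
      norm_neg, Complex.norm_real, Real.norm_of_nonneg hv'.le]
    have e : v ^ a.re = v ^ (a - 1).re * v := by
      rw [Complex.sub_re, Complex.one_re]
      conv_rhs => rw [← Real.rpow_one v, ← Real.rpow_mul hv'.le, one_mul, ← Real.rpow_add hv']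
      congr 1; ring
    rw [e]
    have hle : Real.exp (-z.re * v) ≤ Real.exp (-(t.re / 2) * v) := by
      have : t.re / 2 < z.re := hz
      exact Real.exp_le_exp.2 (by nlinarith)
    have := mul_le_mul_of_nonneg_left hle
      (mul_nonneg (Real.rpow_nonneg hv'.le (a - 1).re) hv'.le)
    linarith
  · exact integrableOn_rpow_mul_exp_neg (by linarith) (by linarith)
  · refine ae_of_all _ fun v z _ => ?_
    have h1 := (hasDerivAt_id z).fun_neg.mul_const (v : ℂ)
    have h2 := h1.cexp.const_mul ((v : ℂ) ^ (a - 1))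
    simpa using h2

/-- Euler's integral for the Gamma function, with a complex scale in the right half plane. -/
theorem mellin_exp_neg_mul {t a : ℂ} (ht : 0 < t.re) (ha : 0 < a.re) :
    mellin (fun v : ℝ => Complex.exp (-t * v)) a = t ^ (-a) * Complex.Gamma a := by
  have hU : IsOpen {z : ℂ | 0 < z.re} := isOpen_lt continuous_const Complex.continuous_re
  have hf : AnalyticOnNhd ℂ (fun t : ℂ => mellin (fun v : ℝ => Complex.exp (-t * v)) a)
      {z : ℂ | 0 < z.re} :=
    DifferentiableOn.analyticOnNhd
      (fun z hz => (differentiableAt_mellin_exp_neg_mul hz ha).differentiableWithinAt) hU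
  have hg : AnalyticOnNhd ℂ (fun t : ℂ => t ^ (-a) * Complex.Gamma a) {z : ℂ | 0 < z.re} := by
    refine DifferentiableOn.analyticOnNhd
      (fun z hz => DifferentiableAt.differentiableWithinAt ?_) hU
    exact (differentiableAt_id.cpow_const (Or.inl hz)).mul_const _
  have hreal : ∀ r : ℝ, 0 < r → mellin (fun v : ℝ => Complex.exp (-(r : ℂ) * v)) a =
      (r : ℂ) ^ (-a) * Complex.Gamma a := fun r hr => by
    have h := Complex.integral_cpow_mul_exp_neg_mul_Ioi ha hr
    simp only [mellin, smul_eq_mul, neg_mul, h]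
    rw [one_div, Complex.inv_cpow _ _ (by simp [Complex.arg_ofReal_of_nonneg hr.le, Real.pi_ne_zero.symm]),
      Complex.cpow_neg]
  -- The formula for real scales, used at points accumulating at 1, suffices for the identity
  -- theorem.
  have hfreq : ∃ᶠ z in 𝓝[≠] (1 : ℂ), mellin (fun v : ℝ => Complex.exp (-z * v)) a =
      z ^ (-a) * Complex.Gamma a := by
    have hlim : Tendsto (fun n : ℕ => ((1 + 1 / ((n : ℝ) + 1) : ℝ) : ℂ)) atTop (𝓝[≠] (1 : ℂ)) := by
      refine tendsto_nhdsWithin_iff.2 ⟨?_, Eventually.of_forall fun n => ?_⟩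
      · have h := (tendsto_one_div_add_atTop_nhds_zero_nat (𝕜 := ℝ)).const_add 1
        rw [add_zero] at h
        have := (Complex.continuous_ofReal.tendsto 1).comp h
        simpa [Function.comp_def] using this
      · have : (1 : ℝ) + 1 / ((n : ℝ) + 1) ≠ 1 := by
          have : 0 < 1 / ((n : ℝ) + 1) := by positivity
          linarith
        simpa only [mem_compl_iff, mem_singleton_iff, Complex.ofReal_eq_one] using this
    exact hlim.frequently (Frequently.of_forall fun n => hreal _ (by positivity))
  exact hf.eqOn_of_preconnected_of_frequently_eq hg (convex_halfSpace_re_gt 0).isPreconnected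
    (z₀ := 1) (by simp) hfreq ht

theorem mellin_gaussian {t s : ℂ} (ht : 0 < t.re) (hs : 0 < s.re) :
    mellin (fun u : ℝ => Complex.exp (-t * (u : ℂ) ^ 2)) s =
      1 / 2 * t ^ (-(s / 2)) * Complex.Gamma (s / 2) := by
  have h := mellin_comp_rpow (fun v : ℝ => Complex.exp (-t * v)) s 2
  have hs2 : 0 < (s / 2).re := by simpa using hs
  have e : (s / ((2 : ℝ) : ℂ)) = s / 2 := by simp
  rw [e, mellin_exp_neg_mul ht hs2] at h
  simp only [Real.rpow_two, Complex.ofReal_pow] at h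
  rw [h, abs_of_pos two_pos, Complex.real_smul]
  push_cast
  ring

theorem StripDecay.gaussian_mul {t r : ℂ} (ht : 0 < t.re) {J : ℂ → ℂ} (hJ : Differentiable ℂ J)
    (hb : ∀ z, ‖J z‖ ≤ Real.exp ‖z‖) :
    StripDecay fun z => Complex.exp (-t * z ^ 2) * J (r * z) := by
  refine ⟨by fun_prop, fun K => ?_⟩
  -- `B` collects the coefficients of `|Re z|`: the cross term of `-t z²`, the growth of `J`, and
  -- the target `exp (-Re z)`. Completing the square gives `B² / (4 Re t)`.
  set B : ℝ := 2 * |t.im| * K + ‖r‖ + 1 with hB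
  refine ⟨Real.exp (B ^ 2 / (4 * t.re) + t.re * K ^ 2 + ‖r‖ * K), fun z hz1 _ => ?_⟩
  have hK : 0 ≤ K := (abs_nonneg _).trans hz1
  rw [norm_mul, Complex.norm_exp, ← Real.exp_add]
  refine (mul_le_mul_of_nonneg_left (hb _) (Real.exp_pos _).le).trans ?_
  rw [← Real.exp_add]
  refine Real.exp_le_exp.2 ?_
  have hre : (-t * z ^ 2).re = -t.re * (z.re ^ 2 - z.im ^ 2) + 2 * t.im * z.re * z.im := by
    simp [pow_two]; ring
  have h1 : ‖r * z‖ ≤ ‖r‖ * |z.re| + ‖r‖ * K := by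
    rw [norm_mul, ← mul_add]
    exact mul_le_mul_of_nonneg_left ((Complex.norm_le_abs_re_add_abs_im z).trans (by linarith))
      (norm_nonneg _)
  have h2 : 2 * t.im * z.re * z.im ≤ 2 * |t.im| * K * |z.re| := by
    calc 2 * t.im * z.re * z.im ≤ |2 * t.im * z.re * z.im| := le_abs_self _
      _ = 2 * |t.im| * |z.re| * |z.im| := by simp [abs_mul]
      _ ≤ 2 * |t.im| * |z.re| * K := mul_le_mul_of_nonneg_left hz1 (by positivity)
      _ = _ := by ring
  have h3 : t.re * z.im ^ 2 ≤ t.re * K ^ 2 := by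
    refine mul_le_mul_of_nonneg_left ?_ ht.le
    rw [← sq_abs]
    exact pow_le_pow_left₀ (abs_nonneg _) hz1 2
  have h4 : -t.re * |z.re| ^ 2 + B * |z.re| ≤ B ^ 2 / (4 * t.re) := by
    rw [le_div_iff₀ (by positivity)]
    nlinarith [sq_nonneg (2 * t.re * |z.re| - B)]
  have h5 := le_abs_self z.re
  rw [sq_abs] at h4
  rw [hre]
  have h6 : B * |z.re| = 2 * |t.im| * K * |z.re| + ‖r‖ * |z.re| + |z.re| := by rw [hB]; ring
  linarith

/-- The norm is the square of `(‖z‖/2)^k / k!`. One factor is bounded by `exp (‖z‖/2)`; the other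
sums to it, whence `‖J₀(z)‖ ≤ exp ‖z‖`. -/
theorem norm_besselJ_zero_term_le (z : ℂ) (k : ℕ) :
    ‖(-1 : ℂ) ^ k / ((k.factorial : ℂ) * ((k + 0).factorial : ℂ)) * (z / 2) ^ (2 * k + 0)‖ ≤
      Real.exp (‖z‖ / 2) * ((‖z‖ / 2) ^ k / k.factorial) := by
  have h := Real.pow_div_factorial_le_exp (‖z‖ / 2) (by positivity) k
  have e : ‖(-1 : ℂ) ^ k / ((k.factorial : ℂ) * ((k + 0).factorial : ℂ)) *
      (z / 2) ^ (2 * k + 0)‖ = (‖z‖ / 2) ^ k / k.factorial * ((‖z‖ / 2) ^ k / k.factorial) := by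
    simp only [add_zero, norm_mul, norm_div, norm_pow, norm_neg, norm_one, one_pow,
      Complex.norm_natCast, Complex.norm_ofNat]
    rw [two_mul, pow_add]
    field_simp
  rw [e]
  exact mul_le_mul_of_nonneg_right h (by positivity)

theorem hasSum_exp_half (x : ℝ) :
    HasSum (fun k : ℕ => Real.exp (x / 2) * ((x / 2) ^ k / k.factorial)) (Real.exp x) := by
  have h := (NormedSpace.expSeries_div_hasSum_exp (x / 2)).mul_left (Real.exp (x / 2))
  rw [← Real.exp_eq_exp_ℝ, ← Real.exp_add, add_halves] at h
  exact h

theorem summable_besselJ_zero (z : ℂ) : Summable fun k : ℕ =>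
    (-1 : ℂ) ^ k / ((k.factorial : ℂ) * ((k + 0).factorial : ℂ)) * (z / 2) ^ (2 * k + 0) :=
  (hasSum_exp_half ‖z‖).summable.of_norm_bounded (norm_besselJ_zero_term_le z)

theorem norm_besselJ_zero_le (z : ℂ) : ‖besselJ 0 z‖ ≤ Real.exp ‖z‖ :=
  tsum_of_norm_bounded (hasSum_exp_half ‖z‖) (norm_besselJ_zero_term_le z)

theorem differentiable_besselJ_zero : Differentiable ℂ (besselJ 0) := fun z => by
  have h : DifferentiableOn ℂ (besselJ 0) (Metric.ball 0 (‖z‖ + 1)) := by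
    refine Complex.differentiableOn_tsum_of_summable_norm (hasSum_exp_half (‖z‖ + 1)).summable
      (fun k => by fun_prop) Metric.isOpen_ball fun k w hw => ?_
    have hw' : ‖w‖ ≤ ‖z‖ + 1 := (mem_ball_zero_iff.1 hw).le
    refine (norm_besselJ_zero_term_le w k).trans ?_
    gcongr
  exact h.differentiableAt (Metric.isOpen_ball.mem_nhds (by simp))

/-- The Gaussian-Bessel function `z ↦ exp (-t z²) J₀(r z)`. -/
def gaussBessel (t r z : ℂ) : ℂ := Complex.exp (-t * z ^ 2) * besselJ 0 (r * z)

theorem stripDecay_gaussBessel {t : ℂ} (ht : 0 < t.re) (r : ℂ) : StripDecay (gaussBessel t r) :=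
  StripDecay.gaussian_mul ht differentiable_besselJ_zero norm_besselJ_zero_le

theorem Gamma_add_natCast {a : ℂ} (ha : 0 < a.re) (k : ℕ) :
    Complex.Gamma (a + k) = (ascPochhammer ℂ k).eval a * Complex.Gamma a := by
  induction k with
  | zero => simp
  | succ k ih =>
    have h : a + k ≠ 0 := by
      intro h
      have := congrArg Complex.re h
      simp at this
      have : (0 : ℝ) ≤ k := k.cast_nonneg
      linarith
    rw [Nat.cast_succ, ← add_assoc, Complex.Gamma_add_one _ h, ih, ascPochhammer_succ_eval]
    ring

theorem integrable_gaussian_mul_exp {a σ b : ℝ} (ha : 0 < a) (hσ : 0 < σ) :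
    IntegrableOn (fun u : ℝ => u ^ (σ - 1) * (Real.exp (-a * u ^ 2) * Real.exp (b * u))) (Ioi 0) := by
  have h := (StripDecay.gaussian_mul (t := (a : ℂ)) (r := (b : ℂ)) (by simpa using ha)
    Complex.differentiable_exp (fun z => by
      rw [Complex.norm_exp]
      exact Real.exp_le_exp.2 (Complex.re_le_norm z))).mellinConvergent (s := σ) (by simpa using hσ)
  refine IntegrableOn.congr_fun h.norm (fun u hu => ?_) measurableSet_Ioi
  simp only [norm_smul, norm_mul, Complex.norm_exp, Complex.norm_cpow_eq_rpow_re_of_pos hu]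
  simp [← Complex.ofReal_pow]

/-- The Mellin transform of `exp (-t u²) J₀(r u)`. -/
theorem mellin_gaussBessel {t s : ℂ} (r : ℂ) (ht : 0 < t.re) (hs : 0 < s.re) :
    mellin (fun u : ℝ => gaussBessel t r u) s =
      1 / 2 * t ^ (-(s / 2)) * Complex.Gamma (s / 2) * hyp1F1 (s / 2) 1 (-r ^ 2 / (4 * t)) := by
  have ht0 : t ≠ 0 := by rintro rfl; simp at ht
  have hs2 : 0 < (s / 2).re := by simpa using hs
  set F : ℕ → ℝ → ℂ := fun k u => (u : ℂ) ^ (s - 1) * (Complex.exp (-t * (u : ℂ) ^ 2) *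
    ((-1 : ℂ) ^ k / ((k.factorial : ℂ) * ((k + 0).factorial : ℂ)) *
      (r * u / 2) ^ (2 * k + 0))) with hF
  -- The `k`-th term is a Gaussian Mellin transform at `s + 2k`; `Γ(s/2 + k)` supplies the
  -- Pochhammer symbol, and one `k!` is `(1)_k`.
  have hterm : ∀ k : ℕ, ∫ u in Ioi (0 : ℝ), F k u = 1 / 2 * t ^ (-(s / 2)) * Complex.Gamma (s / 2) *
      ((ascPochhammer ℂ k).eval (s / 2) / ((ascPochhammer ℂ k).eval 1 * (k.factorial : ℂ)) *
        (-r ^ 2 / (4 * t)) ^ k) := fun k => by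
    have hsk : 0 < (s + 2 * k).re := by simp; positivity
    have h := mellin_gaussian ht hsk
    have e1 : ∫ u in Ioi (0 : ℝ), F k u = ((-1 : ℂ) ^ k / ((k.factorial : ℂ) * (k.factorial : ℂ)) *
        (r / 2) ^ (2 * k)) * mellin (fun u : ℝ => Complex.exp (-t * (u : ℂ) ^ 2)) (s + 2 * k) := by
      rw [mellin, ← integral_const_mul]
      refine setIntegral_congr_fun measurableSet_Ioi fun u hu => ?_
      have hu0 : (u : ℂ) ≠ 0 := by exact_mod_cast (ne_of_gt hu)
      have e2 : (u : ℂ) ^ (s + 2 * k - 1) = (u : ℂ) ^ (s - 1) * (u : ℂ) ^ (2 * k) := by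
        rw [show s + 2 * k - 1 = (s - 1) + ((2 * k : ℕ) : ℂ) by push_cast; ring,
          Complex.cpow_add _ _ hu0, Complex.cpow_natCast]
      simp only [hF, add_zero, smul_eq_mul, e2]
      rw [show r * (u : ℂ) / 2 = r / 2 * u by ring, mul_pow]
      ring
    have e3 : (s + 2 * k) / 2 = s / 2 + k := by ring
    have e4 : t ^ (-(s / 2 + k)) = t ^ (-(s / 2)) / t ^ k := by
      rw [neg_add, Complex.cpow_add _ _ ht0, Complex.cpow_neg t (k : ℂ), Complex.cpow_natCast]
      rfl
    have e5 : (-r ^ 2 / (4 * t)) ^ k = (-1) ^ k * (r / 2) ^ (2 * k) / t ^ k := by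
      rw [pow_mul, ← mul_pow, ← div_pow]
      congr 1
      field_simp
      ring
    rw [e1, h, e3, e4, Gamma_add_natCast hs2, e5, ascPochhammer_eval_one]
    field_simp
  -- The dominating terms sum to `u^(Re s - 1) exp(-Re t u²) exp(‖r‖ u)`, which is integrable.
  have hsum := hasSum_integral_of_dominated_convergence (μ := volume.restrict (Ioi (0 : ℝ)))
    (F := F) (f := fun u => (u : ℂ) ^ (s - 1) * gaussBessel t r u)
    (fun k u => u ^ (s.re - 1) * (Real.exp (-t.re * u ^ 2) *
      (Real.exp (‖r‖ * u / 2) * ((‖r‖ * u / 2) ^ k / k.factorial))))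
    (fun k => ((Complex.measurable_ofReal.pow_const _).mul
      (by fun_prop)).aestronglyMeasurable) (fun k => ?_) ?_ ?_ ?_
  · have := hsum.tsum_eq
    simp only [hterm] at this
    rw [tsum_mul_left] at this
    exact this.symm
  · filter_upwards [ae_restrict_mem measurableSet_Ioi] with u hu
    simp only [hF]
    rw [norm_mul, norm_mul, Complex.norm_cpow_eq_rpow_re_of_pos hu, Complex.norm_exp]
    have hn : ‖r * (u : ℂ)‖ = ‖r‖ * u := by
      rw [norm_mul, Complex.norm_real, Real.norm_of_nonneg (le_of_lt hu)]
    have hb := norm_besselJ_zero_term_le (r * u) k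
    rw [hn] at hb
    have hre : (-t * (u : ℂ) ^ 2).re = -t.re * u ^ 2 := by
      rw [← Complex.ofReal_pow, Complex.re_mul_ofReal, Complex.neg_re]
    rw [hre, Complex.sub_re, Complex.one_re]
    have := Real.rpow_nonneg (le_of_lt hu) (s.re - 1)
    gcongr
  · exact ae_of_all _ fun u =>
      (((hasSum_exp_half (‖r‖ * u)).mul_left _).mul_left _).summable
  · have h := integrable_gaussian_mul_exp (b := ‖r‖) ht hs
    refine h.congr (ae_of_all _ fun u => ?_)
    exact (((hasSum_exp_half (‖r‖ * u)).mul_left _).mul_left _).tsum_eq.symm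
  · exact ae_of_all _ fun u =>
      (((summable_besselJ_zero (r * u)).hasSum).mul_left _).mul_left _

/-! ### The weight of the `Ξ` integral as a product of Fourier transforms. -/

theorem ascPochhammer_eval_conj (a : ℂ) (k : ℕ) :
    (ascPochhammer ℂ k).eval (conj a) = conj ((ascPochhammer ℂ k).eval a) := by
  induction k with
  | zero => simp
  | succ k ih => simp [ascPochhammer_succ_eval, ih]

theorem hyp1F1_conj (a z : ℂ) : hyp1F1 (conj a) 1 (conj z) = conj (hyp1F1 a 1 z) := by
  unfold hyp1F1
  rw [Complex.conj_tsum]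
  refine tsum_congr fun k => ?_
  simp [ascPochhammer_eval_conj, ascPochhammer_eval_one]

/-- For real `z` the two factors are conjugate; this is where the reality of `r²/t` enters. -/
theorem hyp1F1_mul_conj (a : ℂ) {z : ℂ} (hz : z.im = 0) :
    hyp1F1 a 1 z * hyp1F1 (conj a) 1 z = ((‖hyp1F1 a 1 z‖ ^ 2 : ℝ) : ℂ) := by
  have h := hyp1F1_conj a z
  rw [Complex.conj_eq_iff_im.2 hz] at h
  rw [h, Complex.mul_conj']
  push_cast; rfl

theorem riemannXi_eq_completedRiemannZeta {s : ℂ} (hs : s ≠ 0) (hG : s.Gammaℝ ≠ 0) :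
    riemannXi s = 1 / 2 * s * (s - 1) * completedRiemannZeta s := by
  rw [riemannXi, riemannZeta_def_of_ne_zero hs]
  rw [Complex.Gammaℝ_def] at hG ⊢
  rw [show -s / 2 = -(s / 2) by ring] at hG ⊢
  have h1 := left_ne_zero_of_mul hG
  have h2 := right_ne_zero_of_mul hG
  field_simp

/-- The functional equation of the completed zeta function, as `y ↦ -y` is `s ↦ 1 - s`. -/
theorem upperXi_neg (y : ℝ) : upperXi (-y) = upperXi y := by
  set s : ℂ := 1 / 2 + Complex.I * y with hs
  have hre : s.re = 1 / 2 := by simp [hs]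
  have e : (1 / 2 + Complex.I * ((-y : ℝ) : ℂ)) = 1 - s := by rw [hs]; push_cast; ring
  have hre' : (1 - s).re = 1 / 2 := by simp [hre]; norm_num
  have h0 : ∀ w : ℂ, w.re = 1 / 2 → w ≠ 0 ∧ w.Gammaℝ ≠ 0 := fun w hw =>
    ⟨by rintro rfl; norm_num at hw, Complex.Gammaℝ_ne_zero_of_re_pos (by rw [hw]; norm_num)⟩
  rw [upperXi, upperXi, e, ← hs, riemannXi_eq_completedRiemannZeta (h0 _ hre').1 (h0 _ hre').2,
    riemannXi_eq_completedRiemannZeta (h0 _ hre).1 (h0 _ hre).2, completedRiemannZeta_one_sub]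
  ring

theorem sqrt_pi_eq_cpow : (Real.sqrt π : ℂ) = (π : ℂ) ^ (1 / 2 : ℂ) := by
  rw [Real.sqrt_eq_rpow, Complex.ofReal_cpow Real.pi_pos.le]
  push_cast; rfl

variable {t r : ℂ}

theorem besselThetaTerm_eq (t r : ℂ) (y : ℝ) :
    besselThetaTerm t r y = fun n : ℕ => gaussBessel t r (((n + 1 : ℝ) * y : ℝ)) := by
  ext n
  rw [besselThetaTerm, gaussBessel]
  push_cast
  rw [mul_pow]
  simp only [mul_assoc]

theorem besselH_eq_thetaDefect (ht : 0 < t.re) (r : ℂ) :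
    besselH t r = thetaDefect (gaussBessel t r) := by
  ext y
  rw [besselH, thetaDefect, besselThetaTerm_eq, ← StripDecay.mellin_one,
    mellin_gaussBessel r ht (by simp), Complex.Gamma_one_half_eq, ← sqrt_pi_eq_cpow,
    Complex.cpow_neg]
  ring

theorem upperXi_sq_mul_eq (ht : 0 < t.re) (hr : (r ^ 2 / t).im = 0) (y : ℝ) :
    upperXi y ^ 2 / ((y : ℂ) ^ 2 + 1 / 4) ^ 2
      * ((‖hyp1F1 (1 / 4 + Complex.I * (y : ℂ) / 2) 1 (-r ^ 2 / (4 * t))‖ ^ 2 : ℝ) : ℂ) =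
    t ^ (1 / 2 : ℂ) / Real.sqrt π *
      (𝓕 (logScale (1 / 2) (thetaDefect (gaussBessel t r))) ((2 * π)⁻¹ * y) *
        𝓕 (logScale (1 / 2) (thetaDefect (gaussBessel t r))) (-((2 * π)⁻¹ * y))) := by
  have ht0 : t ≠ 0 := by rintro rfl; simp at ht
  have hπ : (π : ℂ) ≠ 0 := by exact_mod_cast Real.pi_ne_zero
  have hsd := stripDecay_gaussBessel ht r
  rw [hsd.fourier_logScale_thetaDefect, hsd.fourier_logScale_thetaDefect]
  set s : ℂ := 1 / 2 + Complex.I * y with hs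
  have hre : s.re = 1 / 2 := by simp [hs]
  have hre' : (1 - s).re = 1 / 2 := by simp [hre]; norm_num
  have e1 : (1 / 2 + 2 * π * (((2 * π)⁻¹ * y : ℝ) : ℂ) * Complex.I) = s := by
    rw [hs]; push_cast; field_simp
  have e2 : (1 / 2 + 2 * π * ((-((2 * π)⁻¹ * y) : ℝ) : ℂ) * Complex.I) = 1 - s := by
    rw [hs]; push_cast; field_simp; ring
  rw [e1, e2, mellin_gaussBessel r ht (by rw [hre]; norm_num),
    mellin_gaussBessel r ht (by rw [hre']; norm_num)]
  have e3 : 1 / 4 + Complex.I * (y : ℂ) / 2 = s / 2 := by rw [hs]; ring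
  have e4 : conj (s / 2) = (1 - s) / 2 := by
    have h2 : conj (2 : ℂ) = 2 := map_ofNat _ 2
    rw [hs]; simp [h2]; ring
  have him : (-r ^ 2 / (4 * t)).im = 0 := by
    have : -r ^ 2 / (4 * t) = ((-1 / 4 : ℝ) : ℂ) * (r ^ 2 / t) := by push_cast; field_simp
    rw [this, Complex.im_ofReal_mul, hr, mul_zero]
  have e5 := hyp1F1_mul_conj (s / 2) him
  rw [e4] at e5
  rw [e3, ← e5]
  have e6 : upperXi y ^ 2 = ((y : ℂ) ^ 2 + 1 / 4) ^ 2 * (1 / 4 * (π : ℂ) ^ (-(1 / 2) : ℂ) *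
      Complex.Gamma (s / 2) * Complex.Gamma ((1 - s) / 2) * riemannZeta s *
      riemannZeta (1 - s)) := by
    have h1 : 1 / 2 + Complex.I * ((-y : ℝ) : ℂ) = 1 - s := by rw [hs]; push_cast; ring
    have h2 : (π : ℂ) ^ (-(1 / 2) : ℂ) = (π : ℂ) ^ (-s / 2) * (π : ℂ) ^ (-(1 - s) / 2) := by
      rw [← Complex.cpow_add _ _ hπ]; congr 1; ring
    have h3 : (y : ℂ) ^ 2 + 1 / 4 = -(s * (s - 1)) := by
      rw [hs]; linear_combination (y : ℂ) ^ 2 * Complex.I_sq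
    rw [pow_two (upperXi y)]
    -- One factor becomes `Ξ(-y)`, so that `ζ(s) ζ(1 - s)` appears as in the product of the two
    -- Müntz formulas.
    nth_rewrite 2 [← upperXi_neg]
    rw [upperXi, upperXi, h1, ← hs, riemannXi, riemannXi, h2, h3]
    ring
  have hy : (y : ℂ) ^ 2 + 1 / 4 ≠ 0 := by
    have : (y ^ 2 + 1 / 4 : ℝ) ≠ 0 := by positivity
    exact fun h => this (Complex.ofReal_eq_zero.1 (by push_cast; exact h))
  have e7 : t ^ (-(s / 2)) * t ^ (-((1 - s) / 2)) * t ^ (1 / 2 : ℂ) = 1 := by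
    rw [← Complex.cpow_add _ _ ht0, ← Complex.cpow_add _ _ ht0]
    convert Complex.cpow_zero t using 2
    ring
  rw [e6, mul_div_cancel_left₀ _ (pow_ne_zero 2 hy), sqrt_pi_eq_cpow, Complex.cpow_neg]
  linear_combination (-(1 / 4) * ((π : ℂ) ^ (1 / 2 : ℂ))⁻¹ * Complex.Gamma (s / 2) *
    Complex.Gamma ((1 - s) / 2) * riemannZeta s * riemannZeta (1 - s) *
    hyp1F1 (s / 2) 1 (-r ^ 2 / (4 * t)) * hyp1F1 ((1 - s) / 2) 1 (-r ^ 2 / (4 * t))) * e7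

/-! ### Reduction to a cosine integral and conclusion. -/

theorem integral_even_mul_exp {P : ℝ → ℂ} (hP : ∀ ξ, P (-ξ) = P ξ) (hi : Integrable P) (x : ℝ) :
    ∫ ξ, P ξ * Complex.exp (((-2 * π * x * ξ : ℝ) : ℂ) * Complex.I) =
      2 * ∫ ξ in Ioi (0 : ℝ), P ξ * (Real.cos (2 * π * x * ξ) : ℂ) := by
  have hint : ∀ c : ℝ, Integrable fun ξ : ℝ => P ξ * Complex.exp (((c * ξ : ℝ) : ℂ) * Complex.I) :=
    fun c => hi.mul_bdd (c := 1) (by fun_prop) (ae_of_all _ fun ξ => by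
      rw [Complex.norm_exp_ofReal_mul_I])
  have h := hint (-2 * π * x)
  rw [← intervalIntegral.integral_Iic_add_Ioi h.integrableOn h.integrableOn (b := 0)]
  have h2 := integral_comp_neg_Ioi 0
    (fun ξ : ℝ => P ξ * Complex.exp (((-2 * π * x * ξ : ℝ) : ℂ) * Complex.I))
  rw [neg_zero] at h2
  rw [← h2, ← integral_const_mul, ← integral_add]
  · refine setIntegral_congr_fun measurableSet_Ioi fun ξ _ => ?_
    simp only [hP]
    rw [Complex.ofReal_cos, Complex.cos]
    have a1 : ((-2 * π * x * -ξ : ℝ) : ℂ) * Complex.I = ((2 * π * x * ξ : ℝ) : ℂ) * Complex.I := by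
      push_cast; ring
    have a2 : ((-2 * π * x * ξ : ℝ) : ℂ) * Complex.I = -((2 * π * x * ξ : ℝ) : ℂ) * Complex.I := by
      push_cast; ring
    rw [a1, a2]
    ring
  · refine ((hint (2 * π * x)).congr (ae_of_all _ fun ξ => ?_)).integrableOn
    simp only [hP]
    congr 4; ring
  · exact h.integrableOn

end

theorem theorem1p1 (t r : ℂ) (ht : 0 < t.re) (hr : (r ^ 2 / t).im = 0) (x : ℝ) :
    (∀ y : ℝ, 0 < y → Summable (besselThetaTerm t r y)) ∧
    IntegrableOn (fun y : ℝ => xiIntegrand t r x y) (Ioi 0) ∧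
    IntegrableOn (fun y : ℝ => besselH t r (y * Real.exp (-x)) * besselH t r y) (Ioi 0) ∧
    ∫ y in Ioi (0 : ℝ), xiIntegrand t r x y =
      (Real.exp (-x / 2) : ℂ) * (Real.sqrt Real.pi : ℂ) * t ^ (1 / 2 : ℂ) *
        ∫ y in Ioi (0 : ℝ), besselH t r (y * Real.exp (-x)) * besselH t r y := by
  have hsd := stripDecay_gaussBessel ht r
  set h : ℝ → ℂ := logScale (1 / 2) (thetaDefect (gaussBessel t r)) with hh
  have hc : Continuous h := hsd.continuous_logScale_thetaDefect
  have hi : Integrable h := hsd.integrable_logScale_thetaDefect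
  have hF : Integrable (𝓕 h) := hsd.integrable_fourier_logScale_thetaDefect
  set P : ℝ → ℂ := fun ξ => 𝓕 h ξ * 𝓕 h (-ξ) with hP
  have hPe : ∀ ξ, P (-ξ) = P ξ := fun ξ => by simp only [hP, neg_neg]; ring
  have hPi : Integrable P :=
    hF.mul_bdd (c := ∫ v, ‖h v‖)
      ((continuous_fourier_of_integrable hi).comp continuous_neg).aestronglyMeasurable
      (ae_of_all _ fun ξ => norm_fourier_le_integral_norm h (-ξ))
  have hPic : Integrable fun ξ => P ξ * (Real.cos (2 * π * x * ξ) : ℂ) :=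
    hPi.mul_bdd (c := 1) (by fun_prop) (ae_of_all _ fun ξ => by
      rw [Complex.norm_real]; exact Real.abs_cos_le_one _)
  -- The substitution is `y = 2πξ`; its Jacobian `2π` later meets the factor 2 from evenness, and
  -- `π/√π = √π` remains.
  have hxi : (fun y => xiIntegrand t r x y) = fun y : ℝ => t ^ (1 / 2 : ℂ) / Real.sqrt π *
      (fun ξ => P ξ * (Real.cos (2 * π * x * ξ) : ℂ)) ((2 * π)⁻¹ * y) := by
    ext y
    have e : 2 * π * x * ((2 * π)⁻¹ * y) = x * y := by field_simp
    simp only [xiIntegrand, upperXi_sq_mul_eq ht hr, hP, e]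
    ring
  have hpos : (0 : ℝ) < (2 * π)⁻¹ := by positivity
  rw [hxi, besselH_eq_thetaDefect ht r]
  refine ⟨fun y hy => ?_, ?_, ?_, ?_⟩
  · rw [besselThetaTerm_eq]
    exact hsd.summable hy
  · exact ((hPic.comp_mul_left' hpos.ne').const_mul _).integrableOn
  · rw [integrableOn_Ioi_iff_logScale, logScale_mul_comp]
    exact (integrable_mul_shift hc hi hF x).const_mul _
  · have e0 := integral_comp_mul_left_Ioi
      (fun ξ => P ξ * (Real.cos (2 * π * x * ξ) : ℂ)) 0 hpos
    rw [integral_const_mul, e0, integral_Ioi_eq_logScale,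
      logScale_mul_comp, integral_const_mul, integral_mul_shift_eq_integral_fourier hc hi hF]
    have e1 : ∫ ξ, 𝓕 h ξ * (𝓕 h (-ξ) * Complex.exp (((-2 * π * x * ξ : ℝ) : ℂ) * Complex.I)) =
        2 * ∫ ξ in Ioi (0 : ℝ), P ξ * (Real.cos (2 * π * x * ξ) : ℂ) := by
      rw [← integral_even_mul_exp hPe hPi x]
      simp only [hP, mul_assoc]
    rw [e1, mul_zero, inv_inv, Complex.real_smul]
    set A := ∫ ξ in Ioi (0 : ℝ), P ξ * (Real.cos (2 * π * x * ξ) : ℂ)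
    have e2 : (Real.exp (-x / 2) : ℂ) * Real.exp (x / 2) = 1 := by
      rw [← Complex.ofReal_mul, ← Real.exp_add]; simp [neg_div]
    have e3 : (Real.sqrt π : ℂ) * Real.sqrt π = π := by
      rw [← Complex.ofReal_mul, Real.mul_self_sqrt Real.pi_pos.le]
    have e4 : (Real.sqrt π : ℂ) ≠ 0 := by
      exact_mod_cast (Real.sqrt_pos.2 Real.pi_pos).ne'
    rw [div_mul_eq_mul_div, div_eq_iff e4]
    push_cast at e2 e3 ⊢
    linear_combination (-2 * t ^ (1 / 2 : ℂ) * A) * (Real.sqrt π : ℂ) * (Real.sqrt π : ℂ) * e2 -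
      2 * t ^ (1 / 2 : ℂ) * A * e3
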